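/- A packing sequence is an infinite non-decreasing sequence $S=(s_1,s_2,\ldots)$ of positive integers. An $S$-packing $k$-coloring of a graph $G$ is a map $\phi\colon V(G)\to\{1,\ldots,k\}$ such that any two distinct vertices $u,v$ with $\phi(u)=\phi(v)=i$ satisfy $d_G(u,v)>s_i$, where the distance between vertices in different components is infinite. The $S$-packing chromatic number $\chi_S(G)$ is the least $k$ for which $G$ has an $S$-packing $k$-coloring, and $G$ is $\chi_S$-critical if $\chi_S(H)<\chi_S(G)$ for every proper subgraph $H$ of $G$. Let $\mathcal S_{a_1,a_2,a_3,a_4}$ be the set of packing sequences with $s_i=a_i$ for $1\le i\le 4$, and let $C_n$ be the cycle with $n$ vertices. **Theorem 4.2.** Let $n\ge 3$ be an integer and let $S$ be a packing sequence. (i) If $S\in\mathcal S_{1,3,4,4}$, then $C_n$ is $\chi_S$-critical if and only if $n\in\{3,5,6,7,9\}$. (ii) If $S\in\mathcal S_{1,3,4,5}$, then $C_n$ is $\chi_S$-critical if and only if $n\in\{3,5,6,7,9,10,11,15,17,23\}$. (iii) If $S\in\mathcal S_{1,3,5,5}$, then $C_n$ is $\chi_S$-critical if and only if $n\in\{6,10\}$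 or $n$ is odd. -/

import Mathlib

/-- `S` is a packing sequence `(s₁, s₂, …)`: an infinite non-decreasing sequence of positive
integers. The term `s_i` is `S i` for `i ≥ 1`; the value `S 0` is never used. -/
def IsPackingSequence (S : ℕ → ℕ) : Prop :=
  (∀ i, 1 ≤ i → 1 ≤ S i) ∧ ∀ i j, 1 ≤ i → i ≤ j → S i ≤ S j

/-- The family `𝒮_{a₁,…,a_m}` of all packing sequences with `s_1 = a₁, …, s_m = a_m`
(the list `a` is indexed from `0`, the sequence from `1`). -/
def packingFamily (a : List ℕ) : Set (ℕ → ℕ) :=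
  {S | IsPackingSequence S ∧ ∀ (i : ℕ) (hi : i < a.length), S (i + 1) = a[i]}

/-- `φ` is an `S`-packing `k`-coloring of `G`: it takes values in `{1, …, k}`, and two distinct
vertices with the same color `i` are at distance greater than `s_i` in `G`. The distance is the
extended one, infinite between different components. -/
def IsPackingColoring {V : Type*} (G : SimpleGraph V) (S : ℕ → ℕ) (k : ℕ) (φ : V → ℕ) : Prop :=
  (∀ v, 1 ≤ φ v ∧ φ v ≤ k) ∧ ∀ u v, u ≠ v → φ u = φ v → (S (φ u) : ℕ∞) < G.edist u v

/-- The `S`-packing chromatic number `χ_S(G)`: the least `k` for which `G` has an `S`-packing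
`k`-coloring, and `⊤` if there is none (this does not happen for finite `G`). -/
noncomputable def packingChromaticNumber {V : Type*} (G : SimpleGraph V) (S : ℕ → ℕ) : ℕ∞ :=
  ⨅ k ∈ {k : ℕ | ∃ φ : V → ℕ, IsPackingColoring G S k φ}, (k : ℕ∞)

/-- `G` is `χ_S`-critical: `χ_S(H) < χ_S(G)` for every proper subgraph `H` of `G`, where distances
for `χ_S(H)` are taken in `H`. -/
def IsPackingCritical {V : Type*} (G : SimpleGraph V) (S : ℕ → ℕ) : Prop :=
  ∀ H : G.Subgraph, H ≠ ⊤ → packingChromaticNumber H.coe S < packingChromaticNumber G S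

/-! Every proper subgraph of C_n misses an edge, so its distances are at least those on a path with
n vertices, and the word 1 2 1 3 1 2 1 4 of period 8 colors it when s_3, s_4 ≤ 7. Hence C_n is
critical as soon as the colors among the first n letters do not suffice for it. Conversely, three
colors with separations at least 1, 3, 4 cannot color a path on 8 vertices. For n ≥ 8, criticality
thus means that C_n has no packing 4-coloring (`isPackingCritical_cycleGraph_four_colors`,
`not_isPackingCritical_cycleGraph_of_isCyclicWord`); smaller n are checked directly.

Colorings of C_n are cyclic words. Those sharing a prefix as long as the largest separation can be
concatenated (`HasLoop.add`), so their lengths are closed under addition: 5, 6, 8 generate enough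
for 1,3,4,4, while 6, 8, 13 serve 1,3,4,5 and 6, 8 serve 1,3,5,5. The other n ≥ 8 are excluded by
finite enumeration, except odd n for 1,3,5,5, where color 1 must alternate
(`IsCyclicWord.even_of_one_three_five_five`). -/

/-! ### Words with prescribed distances between equal letters -/

/-- In `l`, two equal letters `c` are at positions that differ by more than `a c`. -/
def Spaced (a : ℕ → ℕ) : List ℕ → Prop
  | [] => True
  | x :: t => x ∉ t.take (a x) ∧ Spaced a t

instance Spaced.decidable (a : ℕ → ℕ) : ∀ l, Decidable (Spaced a l)
  | [] => isTrue trivial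
  | x :: t =>
    have := Spaced.decidable a t
    inferInstanceAs (Decidable (x ∉ t.take (a x) ∧ Spaced a t))

/-- All spaced words of length `L` over the alphabet `{1, …, k}`. -/
def spacedWords (a : ℕ → ℕ) (k : ℕ) : ℕ → List (List ℕ)
  | 0 => [[]]
  | L + 1 => (spacedWords a k L).flatMap fun t =>
      ((List.range' 1 k).filter fun c => decide (c ∉ t.take (a c))).map (· :: t)

/-- The spacing function `c ↦ a_c` given by the list `a₁, a₂, …`. -/
def spacing (a : List ℕ) (c : ℕ) : ℕ := a.getD (c - 1) 0

theorem Spaced.mem_spacedWords {a : ℕ → ℕ} {k : ℕ} {l : List ℕ} (h : Spaced a l)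
    (hk : ∀ c ∈ l, 1 ≤ c ∧ c ≤ k) : l ∈ spacedWords a k l.length := by
  induction l with
  | nil => simp [spacedWords]
  | cons x t ih =>
    have hx := hk x (by simp)
    simp only [List.length_cons, spacedWords, List.mem_flatMap, List.mem_map, List.mem_filter,
      List.mem_range'_1]
    exact ⟨t, ih h.2 fun c hc => hk c (by simp [hc]), x, ⟨by omega, by simpa using h.1⟩, rfl⟩

/-- The overlap `p` is at least as long as the reach of any letter of `x`, so no clash can cross it.
-/
theorem Spaced.append {a : ℕ → ℕ} {x p r : List ℕ} (hx : Spaced a (x ++ p))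
    (hr : Spaced a (p ++ r)) (hp : ∀ c ∈ x, a c ≤ p.length) : Spaced a (x ++ (p ++ r)) := by
  induction x with
  | nil => exact hr
  | cons y t ih =>
    refine ⟨?_, ih hx.2 fun c hc => hp c (by simp [hc])⟩
    have h1 := hx.1
    have h2 := hp y (by simp)
    change y ∉ (t ++ p).take (a y) at h1
    change y ∉ (t ++ (p ++ r)).take (a y)
    rwa [← List.append_assoc, List.take_append_of_le_length (by simp; omega)]

theorem Spaced.getD_ne {a : ℕ → ℕ} {l : List ℕ} (h : Spaced a l) {i d : ℕ} (hd : 1 ≤ d)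
    (hl : i + d < l.length) (ha : d ≤ a (l.getD i 0)) : l.getD (i + d) 0 ≠ l.getD i 0 := by
  induction l generalizing i with
  | nil => simp at hl
  | cons x t ih =>
    cases i with
    | zero =>
      obtain ⟨e, rfl⟩ : ∃ e, d = e + 1 := ⟨d - 1, by omega⟩
      simp only [List.getD_cons_zero, List.length_cons, zero_add, List.getD_cons_succ] at *
      have he : e < t.length := by omega
      intro hx
      apply h.1
      rw [List.mem_take_iff_getElem]
      refine ⟨e, by omega, ?_⟩
      rwa [List.getD_eq_getElem _ _ he] at hx
    | succ i =>
      rw [show i + 1 + d = (i + d) + 1 by omega, List.getD_cons_succ, List.getD_cons_succ]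
      exact ih h.2 (by simp at hl; omega) (by simpa using ha)

theorem spaced_map_range' {a w : ℕ → ℕ} {i N : ℕ}
    (h : ∀ j d, i ≤ j → 1 ≤ d → j + d < i + N → d ≤ a (w j) → w (j + d) ≠ w j) :
    Spaced a ((List.range' i N).map w) := by
  induction N generalizing i with
  | zero => trivial
  | succ N ih =>
    rw [List.range'_succ, List.map_cons]
    refine ⟨?_, ih fun j d hj hd hN => h j d (by omega) hd (by omega)⟩
    intro hm
    rw [List.mem_take_iff_getElem] at hm
    obtain ⟨e, he, hw⟩ := hm
    simp only [List.length_map, List.length_range', lt_inf_iff] at he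
    simp only [List.getElem_map, List.getElem_range', one_mul] at hw
    exact h i (e + 1) le_rfl (by omega) (by omega) (by omega) (by rw [← hw]; congr 1; omega)

theorem Spaced.congr {a b : ℕ → ℕ} {l : List ℕ} (h : Spaced a l) (hab : ∀ c ∈ l, a c = b c) :
    Spaced b l := by
  induction l with
  | nil => trivial
  | cons x t ih =>
    exact ⟨hab x (by simp) ▸ h.1, ih h.2 fun c hc => hab c (by simp [hc])⟩

theorem map_range'_mem_spacedWords {a w : ℕ → ℕ} {k i N : ℕ}
    (hk : ∀ j, i ≤ j → j < i + N → 1 ≤ w j ∧ w j ≤ k)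
    (h : ∀ j d, i ≤ j → 1 ≤ d → j + d < i + N → d ≤ a (w j) → w (j + d) ≠ w j) :
    (List.range' i N).map w ∈ spacedWords a k N := by
  have := (spaced_map_range' h).mem_spacedWords (k := k) (by
    intro c hc
    simp only [List.mem_map, List.mem_range'_1] at hc
    obtain ⟨j, hj, rfl⟩ := hc
    exact hk j hj.1 hj.2)
  simpa using this

/-! ### Cyclic words -/

/-- `w` is a word of period `n` over `{1, …, k}` that describes an `S`-packing coloring of the
cycle of length `n`. -/
structure IsCyclicWord (S : ℕ → ℕ) (k n : ℕ) (w : ℕ → ℕ) : Prop where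
  mem : ∀ i, 1 ≤ w i ∧ w i ≤ k
  periodic : ∀ i, w (i + n) = w i
  ne : ∀ i d, 1 ≤ d → d < n → d ≤ S (w i) → w (i + d) ≠ w i

theorem IsCyclicWord.exists_spacedWords {S a : ℕ → ℕ} {k n m : ℕ} {w : ℕ → ℕ}
    (h : IsCyclicWord S k n w) (ha : ∀ c ∈ List.range' 1 k, a c ≤ S c ∧ a c < n) (hm : m ≤ n) :
    ∃ l ∈ spacedWords a k n, Spaced a (l ++ l.take m) := by
  have key : ∀ j d, 1 ≤ d → d ≤ a (w j) → w (j + d) ≠ w j := by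
    intro j d hd hda
    have h1 := h.mem j
    have h2 := ha (w j) (by rw [List.mem_range'_1]; omega)
    exact h.ne j d hd (by omega) (by omega)
  refine ⟨_, map_range'_mem_spacedWords (i := 0) (fun j _ _ => h.mem j)
    fun j d _ hd _ => key j d hd, ?_⟩
  have h2 : (List.range' 0 n).map w ++ ((List.range' 0 n).map w).take m
      = (List.range' 0 (n + m)).map w := by
    apply List.ext_getElem
    · simp [hm]
    · intro i h1 h2
      simp only [List.length_map, List.length_range'] at h2
      by_cases hi : i < n
      · rw [List.getElem_append_left (by simpa using hi)]
        simp
      · rw [List.getElem_append_right (by simpa using hi)]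
        have := h.periodic (i - n)
        rw [Nat.sub_add_cancel (by omega)] at this
        simp [this]
  rw [h2]
  exact spaced_map_range' fun j d _ hd _ => key j d hd

/-- A list `l` that starts with `p`, with `l ++ p` spaced, closes up to a cyclic word. -/
theorem exists_isCyclicWord_of_spaced {S : ℕ → ℕ} {k : ℕ} {p r : List ℕ}
    (hk : ∀ c ∈ p ++ r, (1 ≤ c ∧ c ≤ k) ∧ S c ≤ p.length)
    (hl : 0 < (p ++ r).length)
    (h : Spaced S ((p ++ r) ++ p)) : ∃ w, IsCyclicWord S k (p ++ r).length w := by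
  set l := p ++ r with hlr
  have hmem : ∀ i, l.getD (i % l.length) 0 ∈ l := by
    intro i
    rw [List.getD_eq_getElem _ _ (Nat.mod_lt i hl)]
    exact List.getElem_mem _
  refine ⟨fun i => l.getD (i % l.length) 0, fun i => (hk _ (hmem i)).1, fun i => by simp, ?_⟩
  intro i d hd hdn hdS
  beta_reduce at hdS ⊢
  have h0 : i % l.length < l.length := Nat.mod_lt i hl
  have h1 : (i + d) % l.length = (i % l.length + d) % l.length := by simp
  rw [h1]
  have h2 := (hk _ (hmem i)).2
  set j := i % l.length
  have h3 : (l ++ p).getD j 0 = l.getD j 0 := by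
    rw [List.getD_append _ _ _ _ h0]
  have hpl : p.length ≤ l.length := by simp [hlr]
  -- The appended `p` repeats the start of `l`, so clashes across the seam become clashes inside `l
  -- ++ p`; `p` is long enough for every separation.
  have h4 := h.getD_ne (i := j) hd (by rw [List.length_append]; omega) (by rw [h3]; exact hdS)
  rw [h3] at h4
  by_cases hj : j + d < l.length
  · rw [Nat.mod_eq_of_lt hj]
    rwa [List.getD_append _ _ _ _ hj] at h4
  · rw [Nat.mod_eq_sub_mod (by omega), Nat.mod_eq_of_lt (by omega)]
    rw [List.getD_append_right _ _ _ _ (by omega)] at h4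
    have hl' := congrArg List.length hlr
    rw [hlr, List.getD_append _ _ _ _ (by omega)]
    exact h4

/-- There is a word of length `n` over `{1, …, k}` that starts with `p` and remains spaced
when followed by `p`. -/
def HasLoop (a : ℕ → ℕ) (k : ℕ) (p : List ℕ) (n : ℕ) : Prop :=
  ∃ r : List ℕ, (p ++ r).length = n ∧ (∀ c ∈ p ++ r, 1 ≤ c ∧ c ≤ k) ∧ Spaced a ((p ++ r) ++ p)

theorem HasLoop.add {a : ℕ → ℕ} {k : ℕ} {p : List ℕ} {m n : ℕ}
    (ha : ∀ c ∈ List.range' 1 k, a c ≤ p.length)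
    (hm : HasLoop a k p m) (hn : HasLoop a k p n) : HasLoop a k p (m + n) := by
  obtain ⟨r, rfl, hr, hr'⟩ := hm
  obtain ⟨t, rfl, ht, ht'⟩ := hn
  refine ⟨r ++ (p ++ t), by simp; omega, ?_, ?_⟩
  · intro c hc
    rw [← List.append_assoc, List.mem_append] at hc
    exact hc.elim (hr c) (ht c)
  · have := Spaced.append (r := t ++ p) hr' (by simpa using ht') fun c hc => ha c (by
      have := hr c hc
      rw [List.mem_range'_1]; omega)
    simpa using this

theorem HasLoop.exists_isCyclicWord {S a : ℕ → ℕ} {k : ℕ} {p : List ℕ} {n : ℕ}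
    (ha : ∀ c ∈ List.range' 1 k, a c ≤ p.length ∧ S c = a c) (hp : 0 < p.length)
    (h : HasLoop a k p n) : ∃ w, IsCyclicWord S k n w := by
  obtain ⟨r, rfl, hr, hr'⟩ := h
  have key : ∀ c ∈ p ++ r, a c ≤ p.length ∧ S c = a c := fun c hc => ha c (by
    have := hr c hc
    rw [List.mem_range'_1]; omega)
  refine exists_isCyclicWord_of_spaced
    (fun c hc => ⟨hr c hc, by have := key c hc; omega⟩) (by simp; omega)
    (hr'.congr fun c hc => (key c ?_).2.symm)
  simp only [List.mem_append] at hc ⊢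
  tauto

/-! ### Distances in cycles and in their proper subgraphs -/

theorem SimpleGraph.edist_le_of_adj_succ {V : Type*} {G : SimpleGraph V} {f : ℕ → V} {i d : ℕ}
    (h : ∀ j, i ≤ j → j < i + d → G.Adj (f j) (f (j + 1))) : G.edist (f i) (f (i + d)) ≤ d := by
  induction d with
  | zero => simp
  | succ d ih =>
    calc G.edist (f i) (f (i + (d + 1)))
        ≤ G.edist (f i) (f (i + d)) + G.edist (f (i + d)) (f (i + d + 1)) :=
          SimpleGraph.edist_triangle
      _ ≤ d + 1 := by
          refine add_le_add (ih fun j h1 h2 => h j h1 (by omega)) ?_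
          exact (SimpleGraph.edist_eq_one_iff_adj.2 (h _ (by omega) (by omega))).le
      _ = ((d + 1 : ℕ) : ℕ∞) := by push_cast; rfl

theorem SimpleGraph.exists_walk_of_edist_le {V : Type*} {G : SimpleGraph V} {u v : V} {m : ℕ}
    (h : G.edist u v ≤ m) : ∃ p : G.Walk u v, p.length ≤ m := by
  obtain ⟨p, hp⟩ := SimpleGraph.exists_walk_of_edist_ne_top (ne_top_of_le_ne_top (by simp) h)
  exact ⟨p, by rw [← hp] at h; exact_mod_cast h⟩

/-- The vertex `i mod n` of the cycle. -/
def cycleVertex (n : ℕ) [NeZero n] (i : ℕ) : Fin n := Fin.ofNat n i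

theorem cycleGraph_adj_iff_val {n : ℕ} {u v : Fin (n + 2)} :
    (SimpleGraph.cycleGraph (n + 2)).Adj u v ↔
      v.val = (u.val + 1) % (n + 2) ∨ u.val = (v.val + 1) % (n + 2) := by
  have key : ∀ u v : Fin (n + 2), u - v = 1 ↔ u.val = (v.val + 1) % (n + 2) := by
    intro u v
    rw [sub_eq_iff_eq_add, Fin.ext_iff, Fin.val_add, add_comm v.val]
    simp
  rw [SimpleGraph.cycleGraph_adj, key, key, or_comm]

theorem cycleGraph_adj_cycleVertex (n i : ℕ) :
    (SimpleGraph.cycleGraph (n + 2)).Adj (cycleVertex (n + 2) i) (cycleVertex (n + 2) (i + 1)) := by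
  rw [cycleGraph_adj_iff_val]
  left
  simp [cycleVertex]

theorem cycleVertex_ne_add {n i d : ℕ} [NeZero n] (hd : 1 ≤ d) (hn : d < n) :
    cycleVertex n i ≠ cycleVertex n (i + d) := by
  intro h
  have h1 : i % n = (i + d) % n := congrArg Fin.val h
  have h2 : n ∣ (i + d) - i := (Nat.modEq_iff_dvd' (by omega)).1 h1
  have := Nat.le_of_dvd (by omega) h2
  omega

theorem IsPackingColoring.isCyclicWord {n k : ℕ} {S : ℕ → ℕ} {φ : Fin (n + 2) → ℕ}
    (h : IsPackingColoring (SimpleGraph.cycleGraph (n + 2)) S k φ) :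
    IsCyclicWord S k (n + 2) fun i => φ (cycleVertex (n + 2) i) := by
  refine ⟨fun i => h.1 _, fun i => ?_, fun i d hd hn hS he => ?_⟩
  · congr 1
    ext
    simp [cycleVertex]
  · have h1 := h.2 _ _ (cycleVertex_ne_add hd hn) he.symm
    have h2 := SimpleGraph.edist_le_of_adj_succ (i := i) (d := d)
      (f := cycleVertex (n + 2)) fun j _ _ => cycleGraph_adj_cycleVertex n j
    have h3 := h1.trans_le h2
    norm_cast at h3
    exact absurd hS (by omega)

/-- A walk lifts to the integers: each step contributes ±1 to the net displacement `z`. -/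
theorem SimpleGraph.Walk.exists_int_cycleGraph {n : ℕ} {u v : Fin (n + 2)}
    (p : (SimpleGraph.cycleGraph (n + 2)).Walk u v) :
    ∃ z : ℤ, |z| ≤ p.length ∧ ((n + 2 : ℕ) : ℤ) ∣ v.val - u.val - z := by
  induction p with
  | nil => exact ⟨0, by simp⟩
  | @cons a b c hab p ih =>
    obtain ⟨z, hz, hd⟩ := ih
    have key : ∀ x y : ℕ, y = (x + 1) % (n + 2) → ((n + 2 : ℕ) : ℤ) ∣ (y : ℤ) - x - 1 := by
      intro x y hy
      have h1 := Nat.mod_add_div (x + 1) (n + 2)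
      rw [← hy] at h1
      refine ⟨-((x + 1) / (n + 2) : ℕ), ?_⟩
      have h2 : ((y : ℤ) + ((n + 2 : ℕ) : ℤ) * ((x + 1) / (n + 2) : ℕ)) = x + 1 := by
        exact_mod_cast h1
      linear_combination h2
    rw [SimpleGraph.Walk.length_cons]
    rcases cycleGraph_adj_iff_val.1 hab with h | h
    · refine ⟨z + 1, ?_, ?_⟩
      · push_cast
        exact (abs_add_le z 1).trans (by simpa using hz)
      · obtain ⟨q, hq⟩ := hd
        obtain ⟨q', hq'⟩ := key _ _ h
        exact ⟨q + q', by linear_combination hq + hq'⟩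
    · refine ⟨z - 1, ?_, ?_⟩
      · push_cast
        exact (abs_sub z 1).trans (by simpa using hz)
      · obtain ⟨q, hq⟩ := hd
        obtain ⟨q', hq'⟩ := key _ _ h
        exact ⟨q - q', by linear_combination hq - hq'⟩

theorem IsCyclicWord.eq_of_modEq {S : ℕ → ℕ} {k n : ℕ} {w : ℕ → ℕ} (h : IsCyclicWord S k n w)
    {i j : ℕ} (hij : i ≡ j [MOD n]) : w i = w j := by
  have key : ∀ i, w (i % n) = w i := by
    intro i
    have : ∀ q, w (i % n + n * q) = w (i % n) := by
      intro q
      induction q with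
      | zero => simp
      | succ q ih => rw [Nat.mul_succ, ← add_assoc, h.periodic, ih]
    rw [← this (i / n), Nat.mod_add_div]
  rw [← key i, ← key j, hij]

theorem IsCyclicWord.isPackingColoring {n k : ℕ} {S w : ℕ → ℕ} (h : IsCyclicWord S k (n + 2) w) :
    IsPackingColoring (SimpleGraph.cycleGraph (n + 2)) S k fun v => w v.val := by
  refine ⟨fun v => h.mem _, fun u v huv he => ?_⟩
  by_contra hlt
  obtain ⟨p, hp⟩ := SimpleGraph.exists_walk_of_edist_le (not_lt.1 hlt)
  obtain ⟨z, hz, hd⟩ := p.exists_int_cycleGraph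
  -- This covers nonnegative displacements; negative ones follow by swapping `u` and `v`. Since a
  -- cyclic word only constrains shifts below the period, `d` is reduced modulo n + 2, and the
  -- residue is nonzero because `u ≠ v`.
  have key : ∀ u v : Fin (n + 2), u ≠ v → w u.val = w v.val → ∀ d : ℕ, d ≤ S (w u.val) →
      ((n + 2 : ℕ) : ℤ) ∣ v.val - u.val - d → False := by
    intro u v huv he d hdS hd
    have h1 : u.val + d ≡ v.val [MOD n + 2] := by
      rw [← Int.natCast_modEq_iff, Int.modEq_iff_dvd]
      convert hd using 1
      push_cast
      ring
    have h2 : ∀ e, e ≡ d [MOD n + 2] → e ≠ 0 := by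
      rintro e he rfl
      apply huv
      have : u.val ≡ v.val [MOD n + 2] := (he.add_left u.val).trans h1
      exact Fin.ext (this.eq_of_lt_of_lt u.isLt v.isLt)
    have h3 := Nat.mod_modEq d (n + 2)
    have h4 := h2 _ h3
    refine h.ne u.val (d % (n + 2)) (by omega) (Nat.mod_lt _ (by omega))
      ((Nat.mod_le _ _).trans hdS) ?_
    rw [he]
    exact h.eq_of_modEq ((h3.add_left _).trans h1)
  have hz' := abs_le.1 (hz.trans (Int.ofNat_le.2 hp))
  rcases le_total 0 z with h0 | h0
  · obtain ⟨d, rfl⟩ := Int.eq_ofNat_of_zero_le h0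
    exact key u v huv he d (by beta_reduce at hz'; omega) hd
  · obtain ⟨d, hd'⟩ := Int.eq_ofNat_of_zero_le (neg_nonneg.2 h0)
    refine key v u huv.symm he.symm d (by beta_reduce at hz' he; rw [← he]; omega) ?_
    obtain ⟨q, hq⟩ := hd
    exact ⟨-q, by linear_combination -hq + hd'⟩

/-- A word that colors the path with `n` vertices colors every proper subgraph of the cycle. -/
theorem isPackingColoring_proper_subgraph {n k : ℕ} {S w : ℕ → ℕ}
    (hk : ∀ i < n + 3, 1 ≤ w i ∧ w i ≤ k)
    (hw : ∀ i d, 1 ≤ d → i + d < n + 3 → d ≤ S (w i) → w (i + d) ≠ w i)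
    {H : (SimpleGraph.cycleGraph (n + 3)).Subgraph} (hH : H ≠ ⊤) :
    ∃ φ, IsPackingColoring H.coe S k φ := by
  -- A missing vertex also entails a missing edge, so an edge from some `e` to its successor is
  -- absent.
  obtain ⟨e, he⟩ : ∃ e : Fin (n + 3), ¬ H.Adj e (cycleVertex (n + 3) (e.val + 1)) := by
    by_contra! hall
    apply hH
    have hadj : ∀ u v, (SimpleGraph.cycleGraph (n + 3)).Adj u v → H.Adj u v := by
      intro u v huv
      rcases cycleGraph_adj_iff_val.1 huv with h | h
      · have : v = cycleVertex (n + 3) (u.val + 1) := Fin.ext h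
        exact this ▸ hall u
      · have : u = cycleVertex (n + 3) (v.val + 1) := Fin.ext h
        exact (this ▸ hall v).symm
    apply SimpleGraph.Subgraph.ext
    · ext v
      simpa using H.edge_vert (hall v)
    · ext u v
      exact ⟨fun h => h.adj_sub, fun h => hadj u v h⟩
  -- The cycle is cut at the missing edge and numbered from the successor of `e`; along edges of `H`
  -- the position then changes by exactly 1.
  let pos : Fin (n + 3) → ℕ := fun v => (v.val + (n + 3) - (e.val + 1)) % (n + 3)
  have pos_lt : ∀ v, pos v < n + 3 := fun v => Nat.mod_lt _ (by omega)
  have pos_eq : ∀ v, pos v = if e.val < v.val then v.val - (e.val + 1)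
      else v.val + (n + 3) - (e.val + 1) := by
    intro v
    have := v.isLt
    have := e.isLt
    split_ifs with h
    · change (v.val + (n + 3) - (e.val + 1)) % (n + 3) = _
      rw [Nat.mod_eq_sub_mod (by omega), Nat.mod_eq_of_lt (by omega)]
      omega
    · exact Nat.mod_eq_of_lt (by omega)
  have pos_inj : Function.Injective pos := by
    intro u v huv
    rw [pos_eq, pos_eq] at huv
    have := v.isLt
    have := u.isLt
    ext
    split_ifs at huv <;> omega
  have pos_succ : ∀ u v : Fin (n + 3), v.val = (u.val + 1) % (n + 3) → u ≠ e →
      pos v = pos u + 1 := by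
    intro u v huv hue
    rw [pos_eq, pos_eq]
    have := v.isLt
    have := u.isLt
    have := e.isLt
    have hue' : u.val ≠ e.val := fun h => hue (Fin.ext h)
    by_cases h : u.val + 1 < n + 3
    · rw [Nat.mod_eq_of_lt h] at huv
      split_ifs <;> omega
    · have h2 : u.val + 1 = n + 3 := by omega
      rw [h2, Nat.mod_self] at huv
      split_ifs <;> omega
  have pos_adj : ∀ u v, H.Adj u v → pos v = pos u + 1 ∨ pos u = pos v + 1 := by
    intro u v huv
    rcases cycleGraph_adj_iff_val.1 huv.adj_sub with h | h
    · refine Or.inl (pos_succ u v h ?_)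
      rintro rfl
      exact he ((Fin.ext h : v = cycleVertex (n + 3) (u.val + 1)) ▸ huv)
    · refine Or.inr (pos_succ v u h ?_)
      rintro rfl
      exact he ((Fin.ext h : u = cycleVertex (n + 3) (v.val + 1)) ▸ huv.symm)
  have pos_walk : ∀ (u v : H.verts) (p : H.coe.Walk u v),
      pos u ≤ pos v + p.length ∧ pos v ≤ pos u + p.length := by
    intro u v p
    induction p with
    | nil => simp
    | cons hab p ih =>
      have := pos_adj _ _ hab
      rw [SimpleGraph.Walk.length_cons]
      omega
  refine ⟨fun v => w (pos v), fun v => hk _ (pos_lt _), fun u v huv he => ?_⟩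
  beta_reduce at he ⊢
  by_contra hlt
  obtain ⟨p, hp⟩ := SimpleGraph.exists_walk_of_edist_le (not_lt.1 hlt)
  have h1 := pos_walk u v p
  have h2 : pos u ≠ pos v := fun h => huv (Subtype.ext (pos_inj h))
  have h3 := pos_lt u
  have h4 := pos_lt v
  rcases lt_or_gt_of_ne h2 with h | h
  · have := hw (pos u) (pos v - pos u) (by omega) (by omega) (by omega)
    rw [Nat.add_sub_cancel' h.le] at this
    exact this he.symm
  · have := hw (pos v) (pos u - pos v) (by omega) (by omega) (by rw [← he]; omega)
    rw [Nat.add_sub_cancel' h.le] at this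
    exact this he

/-- The spanning path of the cycle that omits the edge between the last vertex and `0`. -/
def cyclePath (n : ℕ) : (SimpleGraph.cycleGraph (n + 3)).Subgraph :=
  (⊤ : (SimpleGraph.cycleGraph (n + 3)).Subgraph).deleteEdges
    {s(cycleVertex (n + 3) (n + 2), cycleVertex (n + 3) 0)}

theorem cyclePath_ne_top (n : ℕ) : cyclePath n ≠ ⊤ := by
  intro h
  have h1 : (SimpleGraph.cycleGraph (n + 3)).Adj (cycleVertex (n + 3) (n + 2))
      (cycleVertex (n + 3) 0) := by
    rw [cycleGraph_adj_iff_val]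
    left
    simp [cycleVertex]
  have h2 : (cyclePath n).Adj (cycleVertex (n + 3) (n + 2)) (cycleVertex (n + 3) 0) := by
    rw [h]
    exact h1
  simp [cyclePath] at h2

theorem IsPackingColoring.exists_word_of_cyclePath {n k : ℕ} {S : ℕ → ℕ}
    {φ : (cyclePath n).verts → ℕ} (h : IsPackingColoring (cyclePath n).coe S k φ) :
    ∃ w : ℕ → ℕ, (∀ i, 1 ≤ w i ∧ w i ≤ k) ∧
      ∀ i d, 1 ≤ d → i + d < n + 3 → d ≤ S (w i) → w (i + d) ≠ w i := by
  let f : ℕ → (cyclePath n).verts := fun i => ⟨cycleVertex (n + 3) i, by simp [cyclePath]⟩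
  refine ⟨fun i => φ (f i), fun i => h.1 _, fun i d hd hn hS he => ?_⟩
  have h1 := h.2 (f i) (f (i + d)) (fun hf => cycleVertex_ne_add hd (by omega : d < n + 3)
    (congrArg Subtype.val hf)) he.symm
  have h2 := SimpleGraph.edist_le_of_adj_succ (G := (cyclePath n).coe) (i := i) (d := d)
    (f := f) fun j _ hj => by
      change (cyclePath n).Adj (cycleVertex (n + 3) j) (cycleVertex (n + 3) (j + 1))
      rw [cyclePath, SimpleGraph.Subgraph.deleteEdges_adj]
      refine ⟨cycleGraph_adj_cycleVertex (n + 1) j, ?_⟩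
      rw [Set.mem_singleton_iff, Sym2.eq_iff]
      simp only [cycleVertex, Fin.ext_iff, Fin.val_ofNat]
      rw [Nat.mod_eq_of_lt (by omega : j < n + 3), Nat.mod_eq_of_lt (by omega : j + 1 < n + 3),
        Nat.mod_eq_of_lt (by omega : n + 2 < n + 3), Nat.mod_eq_of_lt (by omega : 0 < n + 3)]
      omega
  have h3 := h1.trans_le h2
  norm_cast at h3
  exact absurd hS (by beta_reduce; omega)

/-! ### Criticality of cycles -/

theorem packingChromaticNumber_le {V : Type*} {G : SimpleGraph V} {S : ℕ → ℕ} {k : ℕ}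
    (h : ∃ φ : V → ℕ, IsPackingColoring G S k φ) : packingChromaticNumber G S ≤ k :=
  iInf₂_le k h

theorem le_packingChromaticNumber {V : Type*} {G : SimpleGraph V} {S : ℕ → ℕ} {k : ℕ}
    (h : ¬ ∃ φ : V → ℕ, IsPackingColoring G S k φ) :
    ((k + 1 : ℕ) : ℕ∞) ≤ packingChromaticNumber G S := by
  refine le_iInf₂ fun j hj => ?_
  obtain ⟨φ, hφ⟩ := hj
  norm_cast
  by_contra! hlt
  exact h ⟨φ, fun v => ⟨(hφ.1 v).1, (hφ.1 v).2.trans (by omega)⟩, hφ.2⟩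

/-- The word `1 2 1 3 1 2 1 4` of period `8`. -/
def octalWord (i : ℕ) : ℕ :=
  if i % 2 = 0 then 1 else if i % 4 = 1 then 2 else if i % 8 = 3 then 3 else 4

theorem isPackingCritical_cycleGraph {n k : ℕ} {S : ℕ → ℕ} (hn : 3 ≤ n)
    (h1 : S 1 = 1) (h2 : S 2 = 3) (h3 : S 3 ≤ 7) (h4 : S 4 ≤ 7)
    (hk : ∀ i < n, octalWord i ≤ k) (hC : ¬ ∃ w, IsCyclicWord S k n w) :
    IsPackingCritical (SimpleGraph.cycleGraph n) S := by
  obtain ⟨n, rfl⟩ : ∃ m, n = m + 3 := ⟨n - 3, by omega⟩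
  intro H hH
  have hle : packingChromaticNumber H.coe S ≤ k := by
    refine packingChromaticNumber_le (isPackingColoring_proper_subgraph (w := octalWord)
      (fun i hi => ⟨?_, hk i hi⟩) ?_ hH)
    · unfold octalWord
      split_ifs <;> omega
    · intro i d hd _ hS
      have hc : (octalWord i = 1 ∧ i % 2 = 0 ∧ d ≤ 1) ∨ (octalWord i = 2 ∧ i % 4 = 1 ∧ d ≤ 3) ∨
          (octalWord i = 3 ∧ i % 8 = 3 ∧ d ≤ 7) ∨ (octalWord i = 4 ∧ i % 8 = 7 ∧ d ≤ 7) := by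
        revert hS
        unfold octalWord
        split_ifs <;> intro hS <;> omega
      rcases hc with ⟨h, hi, hd'⟩ | ⟨h, hi, hd'⟩ | ⟨h, hi, hd'⟩ | ⟨h, hi, hd'⟩ <;>
      · rw [h]
        unfold octalWord
        split_ifs <;> omega
  refine hle.trans_lt (lt_of_lt_of_le ?_ (le_packingChromaticNumber (k := k) ?_))
  · exact_mod_cast Nat.lt_succ_self k
  · rintro ⟨φ, hφ⟩
    exact hC ⟨_, hφ.isCyclicWord⟩

/-- The spanning path already needs k + 1 colors, so deleting one edge does not lower the number.
Since `a` only bounds `S` from below, one enumeration serves a whole family. -/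
theorem not_isPackingCritical_cycleGraph {n k L : ℕ} {S a : ℕ → ℕ} (hn : 3 ≤ n) (hL : L ≤ n)
    (ha : ∀ c ∈ List.range' 1 k, a c ≤ S c) (hP : spacedWords a k L = [])
    (hC : ∃ w, IsCyclicWord S (k + 1) n w) :
    ¬ IsPackingCritical (SimpleGraph.cycleGraph n) S := by
  obtain ⟨n, rfl⟩ : ∃ m, n = m + 3 := ⟨n - 3, by omega⟩
  intro hcrit
  obtain ⟨w, hw⟩ := hC
  have h1 := hcrit _ (cyclePath_ne_top n)
  have h2 : packingChromaticNumber (SimpleGraph.cycleGraph (n + 3)) S ≤ (k + 1 : ℕ) :=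
    packingChromaticNumber_le ⟨_, hw.isPackingColoring⟩
  have h3 : ((k + 1 : ℕ) : ℕ∞) ≤ packingChromaticNumber (cyclePath n).coe S := by
    refine le_packingChromaticNumber ?_
    rintro ⟨φ, hφ⟩
    obtain ⟨w, hwk, hw⟩ := hφ.exists_word_of_cyclePath
    have := map_range'_mem_spacedWords (a := a) (w := w) (k := k) (i := 0) (N := L)
      (fun j _ _ => hwk j) fun j d _ hd hj hda => hw j d hd (by omega) (hda.trans (ha _ (by
        have := hwk j
        rw [List.mem_range'_1]; omega)))
    simp [hP] at this
  exact absurd h1 (not_lt.2 (h2.trans h3))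

/-- Repeating the first `m` letters exposes clashes across the seam. Spacings must stay below `n`,
as a shift by `n` returns to the same vertex. -/
theorem not_exists_isCyclicWord {a : List ℕ} {S : ℕ → ℕ} {k n : ℕ} (m : ℕ)
    (ha : ∀ c ∈ List.range' 1 k, spacing a c ≤ S c)
    (h : (∀ c ∈ List.range' 1 k, spacing a c < n) ∧ m ≤ n ∧
      ∀ l ∈ spacedWords (spacing a) k n, ¬ Spaced (spacing a) (l ++ l.take m)) :
    ¬ ∃ w, IsCyclicWord S k n w := by
  rintro ⟨w, hw⟩
  obtain ⟨l, hl, hl'⟩ := hw.exists_spacedWords (fun c hc => ⟨ha c hc, h.1 c hc⟩) h.2.1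
  exact h.2.2 l hl hl'

/-! ### The sequences that begin with `1, 3, s₃, s₄` -/

theorem spacing_le_of_le {S : ℕ → ℕ} {a b c d : ℕ} (h1 : a ≤ S 1) (h2 : b ≤ S 2) (h3 : c ≤ S 3)
    (h4 : d ≤ S 4) : ∀ i ∈ List.range' 1 4, spacing [a, b, c, d] i ≤ S i := by
  intro i hi
  rw [List.mem_range'_1] at hi
  obtain ⟨hi1, hi2⟩ := hi
  interval_cases i <;> simpa [spacing]

theorem isPackingCritical_cycleGraph_small {n : ℕ} {S : ℕ → ℕ}
    (h1 : S 1 = 1) (h2 : S 2 = 3) (h3 : 4 ≤ S 3 ∧ S 3 ≤ 7) (h4 : S 4 ≤ 7)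
    (hn : n = 3 ∨ n = 5 ∨ n = 6 ∨ n = 7) :
    IsPackingCritical (SimpleGraph.cycleGraph n) S := by
  have ha : ∀ c ∈ List.range' 1 3, spacing [1, 3, 4] c ≤ S c := by
    intro i hi
    rw [List.mem_range'_1] at hi
    obtain ⟨hi1, hi2⟩ := hi
    interval_cases i <;> simp [spacing, h1, h2, h3.1]
  rcases hn with rfl | rfl | rfl | rfl
  · refine isPackingCritical_cycleGraph (k := 2) le_rfl h1 h2 h3.2 h4 (by decide) ?_
    -- The separation 3 of color 2 is weakened to 2 to stay below the period 3.
    refine not_exists_isCyclicWord (a := [1, 2]) 2 ?_ (by decide)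
    intro i hi
    rw [List.mem_range'_1] at hi
    obtain ⟨hi1, hi2⟩ := hi
    interval_cases i <;> simp [spacing, h1, h2]
  all_goals
    refine isPackingCritical_cycleGraph (k := 3) (by norm_num) h1 h2 h3.2 h4 (by decide) ?_
    exact not_exists_isCyclicWord 4 ha (by decide +kernel)

theorem isPackingCritical_cycleGraph_four_colors {n : ℕ} {S : ℕ → ℕ} (hn : 3 ≤ n)
    (h1 : S 1 = 1) (h2 : S 2 = 3) (h3 : S 3 ≤ 7) (h4 : S 4 ≤ 7)
    (hC : ¬ ∃ w, IsCyclicWord S 4 n w) :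
    IsPackingCritical (SimpleGraph.cycleGraph n) S := by
  refine isPackingCritical_cycleGraph hn h1 h2 h3 h4 (fun i _ => ?_) hC
  unfold octalWord
  split_ifs <;> omega

theorem not_isPackingCritical_cycleGraph_of_isCyclicWord {n : ℕ} {S : ℕ → ℕ} (hn : 8 ≤ n)
    (h1 : S 1 = 1) (h2 : S 2 = 3) (h3 : 4 ≤ S 3) (hC : ∃ w, IsCyclicWord S 4 n w) :
    ¬ IsPackingCritical (SimpleGraph.cycleGraph n) S := by
  refine not_isPackingCritical_cycleGraph (k := 3) (L := 8) (a := spacing [1, 3, 4]) (by omega)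
    hn ?_ (by decide +kernel) hC
  intro i hi
  rw [List.mem_range'_1] at hi
  obtain ⟨hi1, hi2⟩ := hi
  interval_cases i <;> simp [spacing, h1, h2, h3]

theorem not_isPackingCritical_cycleGraph_four {S : ℕ → ℕ} (h1 : S 1 = 1) (h2 : S 2 = 3) :
    ¬ IsPackingCritical (SimpleGraph.cycleGraph 4) S := by
  refine not_isPackingCritical_cycleGraph (k := 2) (L := 4) (a := spacing [1, 3]) (by omega)
    le_rfl ?_ (by decide +kernel) ?_
  · intro i hi
    rw [List.mem_range'_1] at hi
    obtain ⟨hi1, hi2⟩ := hi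
    interval_cases i <;> simp [spacing, h1, h2]
  · refine ⟨fun i => if i % 2 = 0 then 1 else if i % 4 = 1 then 2 else 3, ?_, ?_, ?_⟩
    · intro i
      split_ifs <;> omega
    · intro i
      simp [Nat.add_mod]
    · intro i d hd hd4 hS
      split_ifs at hS ⊢ <;> omega

/-! ### Lengths of four-colorable cycles -/

theorem hasLoop_one_three_four_four {n : ℕ} (hn : n = 6 ∨ n = 8 ∨ 10 ≤ n) :
    HasLoop (spacing [1, 3, 4, 4]) 4 [1, 2, 1, 3] n := by
  have b5 : HasLoop (spacing [1, 3, 4, 4]) 4 [1, 2, 1, 3] 5 := ⟨[4], by decide⟩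
  have b6 : HasLoop (spacing [1, 3, 4, 4]) 4 [1, 2, 1, 3] 6 := ⟨[1, 4], by decide⟩
  have b8 : HasLoop (spacing [1, 3, 4, 4]) 4 [1, 2, 1, 3] 8 := ⟨[1, 2, 1, 4], by decide⟩
  have add {m n} := HasLoop.add (a := spacing [1, 3, 4, 4]) (k := 4) (p := [1, 2, 1, 3])
    (m := m) (n := n) (by decide)
  induction n using Nat.strong_induction_on with
  | _ n ih =>
    -- These are the least admissible lengths in the six residue classes modulo 6; adding the loop
    -- of length 6 gives the rest. The next two proofs follow the same scheme.
    by_cases hs : n = 6 ∨ n = 8 ∨ n = 10 ∨ n = 11 ∨ n = 13 ∨ n = 15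
    · rcases hs with rfl | rfl | rfl | rfl | rfl | rfl
      exacts [b6, b8, add b5 b5, add b5 b6, add b5 b8, add b5 (add b5 b5)]
    · have := add b6 (ih (n - 6) (by omega) (by omega))
      rwa [Nat.add_sub_cancel' (by omega)] at this

theorem hasLoop_one_three_five_five {n : ℕ} (hn : 6 ≤ n ∧ n ≠ 10 ∧ Even n) :
    HasLoop (spacing [1, 3, 5, 5]) 4 [1, 2, 1, 3, 1] n := by
  have b6 : HasLoop (spacing [1, 3, 5, 5]) 4 [1, 2, 1, 3, 1] 6 := ⟨[4], by decide⟩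
  have b8 : HasLoop (spacing [1, 3, 5, 5]) 4 [1, 2, 1, 3, 1] 8 := ⟨[2, 1, 4], by decide⟩
  have add {m n} := HasLoop.add (a := spacing [1, 3, 5, 5]) (k := 4) (p := [1, 2, 1, 3, 1])
    (m := m) (n := n) (by decide)
  rw [Nat.even_iff] at hn
  induction n using Nat.strong_induction_on with
  | _ n ih =>
    by_cases hs : n = 6 ∨ n = 8 ∨ n = 16
    · rcases hs with rfl | rfl | rfl
      exacts [b6, b8, add b8 b8]
    · have := add b6 (ih (n - 6) (by omega) (by omega))
      rwa [Nat.add_sub_cancel' (by omega)] at this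

theorem hasLoop_one_three_four_five {n : ℕ}
    (hn : 6 ≤ n ∧ n ∉ ({7, 9, 10, 11, 15, 17, 23} : Set ℕ)) :
    HasLoop (spacing [1, 3, 4, 5]) 4 [1, 2, 1, 3, 1] n := by
  have b6 : HasLoop (spacing [1, 3, 4, 5]) 4 [1, 2, 1, 3, 1] 6 := ⟨[4], by decide⟩
  have b8 : HasLoop (spacing [1, 3, 4, 5]) 4 [1, 2, 1, 3, 1] 8 := ⟨[2, 1, 4], by decide⟩
  have b13 : HasLoop (spacing [1, 3, 4, 5]) 4 [1, 2, 1, 3, 1] 13 :=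
    ⟨[2, 4, 1, 3, 1, 2, 1, 4], by decide⟩
  have add {m n} := HasLoop.add (a := spacing [1, 3, 4, 5]) (k := 4) (p := [1, 2, 1, 3, 1])
    (m := m) (n := n) (by decide)
  simp only [Set.mem_insert_iff, Set.mem_singleton_iff] at hn
  induction n using Nat.strong_induction_on with
  | _ n ih =>
    by_cases hs : n = 6 ∨ n = 8 ∨ n = 13 ∨ n = 16 ∨ n = 21 ∨ n = 29
    · rcases hs with rfl | rfl | rfl | rfl | rfl | rfl
      exacts [b6, b8, b13, add b8 b8, add b8 b13, add b8 (add b8 b13)]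
    · have := add b6 (ih (n - 6) (by omega) (by omega))
      rwa [Nat.add_sub_cancel' (by omega)] at this

/-- Two adjacent 1s clash, and two adjacent letters other than 1 cannot be extended by four letters
on each side. -/
theorem getD_eq_one_iff_of_mem_spacedWords :
    ∀ l ∈ spacedWords (spacing [1, 3, 5, 5]) 4 10, l.getD 4 0 = 1 ↔ l.getD 5 0 ≠ 1 := by
  decide +kernel

/-- In a long cyclic word for `1, 3, 5, 5`, every other letter is `1`. -/
theorem IsCyclicWord.even_of_one_three_five_five {n : ℕ} {S w : ℕ → ℕ}
    (hS : ∀ c ∈ List.range' 1 4, spacing [1, 3, 5, 5] c ≤ S c) (hn : 6 ≤ n)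
    (h : IsCyclicWord S 4 n w) : Even n := by
  have alt : ∀ i, w (i + 4) = 1 ↔ w (i + 5) ≠ 1 := by
    intro i
    have h1 := map_range'_mem_spacedWords (a := spacing [1, 3, 5, 5]) (w := w) (k := 4) (i := i)
      (N := 10) (fun j _ _ => h.mem j) fun j d _ hd _ hda => by
        have h2 := h.mem j
        have hj : w j ∈ List.range' 1 4 := by rw [List.mem_range'_1]; omega
        have h3 : ∀ c ∈ List.range' 1 4, spacing [1, 3, 5, 5] c < 6 := by decide
        exact h.ne j d hd (by have := h3 _ hj; omega) (hda.trans (hS _ hj))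
    simpa [List.range'] using getD_eq_one_iff_of_mem_spacedWords _ h1
  -- Alternation makes the status of position `m + 4` depend on the parity of `m`; at `m = n`
  -- periodicity returns it to that of position 4.
  have parity : ∀ m, (w (m + 4) = 1 ↔ w 4 = 1) ↔ Even m := by
    intro m
    induction m with
    | zero => simp
    | succ m ih =>
      have := alt m
      rw [show m + 1 + 4 = m + 5 by omega, Nat.even_add_one]
      tauto
  exact (parity n).1 (by rw [add_comm n 4, h.periodic])

/-! ### The three families -/

theorem packingFamily_four {S : ℕ → ℕ} {a b c d : ℕ} (h : S ∈ packingFamily [a, b, c, d]) :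
    S 1 = a ∧ S 2 = b ∧ S 3 = c ∧ S 4 = d :=
  ⟨h.2 0 (by simp), h.2 1 (by simp), h.2 2 (by simp), h.2 3 (by simp)⟩

theorem HasLoop.exists_isCyclicWord_four {S : ℕ → ℕ} {a b c d n : ℕ} {p : List ℕ}
    (h : HasLoop (spacing [a, b, c, d]) 4 p n)
    (hS : S 1 = a ∧ S 2 = b ∧ S 3 = c ∧ S 4 = d)
    (hp : 0 < p.length ∧ ∀ i ∈ List.range' 1 4, spacing [a, b, c, d] i ≤ p.length) :
    ∃ w, IsCyclicWord S 4 n w := by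
  refine h.exists_isCyclicWord (fun i hi => ⟨hp.2 i hi, ?_⟩) hp.1
  obtain ⟨rfl, rfl, rfl, rfl⟩ := hS
  rw [List.mem_range'_1] at hi
  obtain ⟨hi1, hi2⟩ := hi
  interval_cases i <;> simp [spacing]

theorem isPackingCritical_cycleGraph_one_three_four_four {S : ℕ → ℕ}
    (hS : S ∈ packingFamily [1, 3, 4, 4]) {n : ℕ} (hn : 3 ≤ n) :
    IsPackingCritical (SimpleGraph.cycleGraph n) S ↔ n ∈ ({3, 5, 6, 7, 9} : Set ℕ) := by
  have hS' := packingFamily_four hS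
  have ⟨h1, h2, h3, h4⟩ := hS'
  have hle := spacing_le_of_le h1.ge h2.ge h3.ge h4.ge
  simp only [Set.mem_insert_iff, Set.mem_singleton_iff]
  constructor
  · intro h
    by_contra hne
    by_cases h8 : 8 ≤ n
    · exact not_isPackingCritical_cycleGraph_of_isCyclicWord h8 h1 h2 h3.ge
        ((hasLoop_one_three_four_four (by omega)).exists_isCyclicWord_four hS' (by decide)) h
    · obtain rfl : n = 4 := by omega
      exact not_isPackingCritical_cycleGraph_four h1 h2 h
  · intro h
    by_cases h7 : n ≤ 7
    · exact isPackingCritical_cycleGraph_small h1 h2 (by omega) (by omega) (by omega)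
    · obtain rfl : n = 9 := by omega
      exact isPackingCritical_cycleGraph_four_colors hn h1 h2 (by omega) (by omega)
        (not_exists_isCyclicWord 4 hle (by decide +kernel))

theorem isPackingCritical_cycleGraph_one_three_four_five {S : ℕ → ℕ}
    (hS : S ∈ packingFamily [1, 3, 4, 5]) {n : ℕ} (hn : 3 ≤ n) :
    IsPackingCritical (SimpleGraph.cycleGraph n) S ↔
      n ∈ ({3, 5, 6, 7, 9, 10, 11, 15, 17, 23} : Set ℕ) := by
  have hS' := packingFamily_four hS
  have ⟨h1, h2, h3, h4⟩ := hS'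
  have hle := spacing_le_of_le h1.ge h2.ge h3.ge h4.ge
  simp only [Set.mem_insert_iff, Set.mem_singleton_iff]
  constructor
  · intro h
    by_contra hne
    by_cases h8 : 8 ≤ n
    · refine not_isPackingCritical_cycleGraph_of_isCyclicWord h8 h1 h2 h3.ge
        ((hasLoop_one_three_four_five ⟨by omega, ?_⟩).exists_isCyclicWord_four hS'
          (by decide)) h
      simp only [Set.mem_insert_iff, Set.mem_singleton_iff]
      omega
    · obtain rfl : n = 4 := by omega
      exact not_isPackingCritical_cycleGraph_four h1 h2 h
  · intro h
    by_cases h7 : n ≤ 7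
    · exact isPackingCritical_cycleGraph_small h1 h2 (by omega) (by omega) (by omega)
    · refine isPackingCritical_cycleGraph_four_colors hn h1 h2 (by omega) (by omega)
        (not_exists_isCyclicWord 5 hle ?_)
      obtain rfl | rfl | rfl | rfl | rfl | rfl :
        n = 9 ∨ n = 10 ∨ n = 11 ∨ n = 15 ∨ n = 17 ∨ n = 23 := by omega
      all_goals decide +kernel

theorem isPackingCritical_cycleGraph_one_three_five_five {S : ℕ → ℕ}
    (hS : S ∈ packingFamily [1, 3, 5, 5]) {n : ℕ} (hn : 3 ≤ n) :
    IsPackingCritical (SimpleGraph.cycleGraph n) S ↔ n ∈ ({6, 10} : Set ℕ) ∨ Odd n := by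
  have hS' := packingFamily_four hS
  have ⟨h1, h2, h3, h4⟩ := hS'
  have hle := spacing_le_of_le h1.ge h2.ge h3.ge h4.ge
  simp only [Set.mem_insert_iff, Set.mem_singleton_iff]
  constructor
  · intro h
    by_contra hne
    rw [not_or, Nat.not_odd_iff_even] at hne
    have hev := Nat.even_iff.1 hne.2
    by_cases h8 : 8 ≤ n
    · exact not_isPackingCritical_cycleGraph_of_isCyclicWord h8 h1 h2 (by omega)
        ((hasLoop_one_three_five_five ⟨by omega, by omega, hne.2⟩).exists_isCyclicWord_four hS'
          (by decide)) h
    · obtain rfl : n = 4 := by omega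
      exact not_isPackingCritical_cycleGraph_four h1 h2 h
  · intro h
    rw [Nat.odd_iff] at h
    by_cases h7 : n ≤ 7
    · exact isPackingCritical_cycleGraph_small h1 h2 (by omega) (by omega) (by omega)
    · refine isPackingCritical_cycleGraph_four_colors hn h1 h2 (by omega) (by omega) ?_
      -- Parity does not exclude 10, which is even but not a sum of 6s and 8s, so it is enumerated.
      by_cases h10 : n = 10
      · subst h10
        exact not_exists_isCyclicWord 5 hle (by decide +kernel)
      · rintro ⟨w, hw⟩
        have := Nat.even_iff.1 (hw.even_of_one_three_five_five hle (by omega))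
        omega

theorem theorem4p2 :
    (∀ S ∈ packingFamily [1, 3, 4, 4], ∀ n : ℕ, 3 ≤ n →
      (IsPackingCritical (SimpleGraph.cycleGraph n) S ↔
        n ∈ ({3, 5, 6, 7, 9} : Set ℕ))) ∧
    (∀ S ∈ packingFamily [1, 3, 4, 5], ∀ n : ℕ, 3 ≤ n →
      (IsPackingCritical (SimpleGraph.cycleGraph n) S ↔
        n ∈ ({3, 5, 6, 7, 9, 10, 11, 15, 17, 23} : Set ℕ))) ∧
    (∀ S ∈ packingFamily [1, 3, 5, 5], ∀ n : ℕ, 3 ≤ n →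
      (IsPackingCritical (SimpleGraph.cycleGraph n) S ↔
        n ∈ ({6, 10} : Set ℕ) ∨ Odd n)) :=
  ⟨fun _ hS _ hn => isPackingCritical_cycleGraph_one_three_four_four hS hn,
    fun _ hS _ hn => isPackingCritical_cycleGraph_one_three_four_five hS hn,
    fun _ hS _ hn => isPackingCritical_cycleGraph_one_three_five_five hS hn⟩
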